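/- Let $M_2(\mathbb C)$ be the $2\times 2$ complex matrices. A qubit channel is a completely positive trace-preserving linear map $\mathcal E:M_2(\mathbb C)\to M_2(\mathbb C)$; it is unital if $\mathcal E[\mathbb 1]=\mathbb 1$. Fix a norm on the (finite-dimensional) space of linear maps on $M_2(\mathbb C)$. A qubit channel is infinitesimally divisible (in CPTP) if it lies in the closure of the set of channels $\mathcal E$ such that for every $\epsilon>0$ there are finitely many channels $\mathcal E_1,\dots,\mathcal E_N$ with $\|\mathcal E_i-\mathrm{id}\|<\epsilon$ for all $i$ and $\mathcal E=\mathcal E_1\cdots\mathcal E_N$. A linear map $L$ has Lindblad form if $$L[\rho]=i[\rho,H]+\sum_{i,j}G_{ij}\Big(F_i\rho F_j^\dagger-\tfrac12\{F_j^\dagger F_i,\rho\}\Big)$$ for a Hermitian $H\in M_2(\mathbb C)$, finitely many $F_i\in M_2(\mathbb C)$ and a Hermitian positive semidefinite matrix $G=(G_{ij})$. A qubit channel is L-divisible if it lies in the closure of the set of non-singular channels of the form $e^L$ with $L$ of Lindblad form. A Pauli channel is a map $\rho\mapsto\sum_{i=0}^3p_i\sigma_i\rho\sigma_i$ with $p_i\ge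 0$, $\sum_ip_i=1$, $\sigma_0=\mathbb 1$ and $\sigma_1,\sigma_2,\sigma_3$ the Pauli matrices. A unitary conjugation is a map $\rho\mapsto U\rho U^\dagger$ with $U$ unitary. Theorem (Infinitesimal divisible unital channels). Let $\mathcal E$ be an infinitesimally divisible (in CPTP) unital qubit channel. Then there exist an L-divisible Pauli channel $\tilde{\mathcal E}$ and two unitary conjugations $\mathcal U_1,\mathcal U_2$ such that $$\mathcal E=\mathcal U_1\,\tilde{\mathcal E}\,\mathcal U_2,$$ where, if $\mathcal E$ is invertible as a linear map, $\tilde{\mathcal E}=e^L$ for some $L$ of Lindblad form. -/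

import Mathlib

open scoped Matrix Matrix.Norms.L2Operator ComplexOrder

namespace QubitChannel

/-- Linear maps `ρ ↦ 𝓔[ρ]` on the `n × n` complex matrices (every linear map is continuous here).
The space carries the operator norm induced by the L2 operator norm on matrices; as it is finite
dimensional, every other norm is equivalent to it. Products are compositions. -/
abbrev SuperOp (n : Type) [Fintype n] [DecidableEq n] : Type :=
  Matrix n n ℂ →L[ℂ] Matrix n n ℂ

section General

variable {n : Type} [Fintype n] [DecidableEq n]

/-- The extended map `id_k ⊗ 𝓔`: it acts by `𝓔` on each `n × n` block of a matrix that is regarded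
as a `k × k` block matrix. -/
noncomputable def ampliate (k : ℕ) (E : SuperOp n) (X : Matrix (Fin k × n) (Fin k × n) ℂ) :
    Matrix (Fin k × n) (Fin k × n) ℂ :=
  Matrix.of fun p q => E (Matrix.of fun a b => X (p.1, a) (q.1, b)) p.2 q.2

/-- On product operators, `(id_k ⊗ 𝓔)[A ⊗ B] = A ⊗ 𝓔[B]`. -/
theorem ampliate_kronecker (k : ℕ) (E : SuperOp n) (A : Matrix (Fin k) (Fin k) ℂ)
    (B : Matrix n n ℂ) :
    ampliate k E (Matrix.kronecker A B) = Matrix.kronecker A (E B) := by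
  ext p q
  have h : (Matrix.of fun a b => Matrix.kronecker A B (p.1, a) (q.1, b)) = A p.1 q.1 • B := by
    ext a b
    simp [Matrix.kronecker, Matrix.kroneckerMap_apply]
  rw [ampliate, Matrix.of_apply, h, map_smul]
  simp [Matrix.kronecker, Matrix.kroneckerMap_apply]

/-- Complete positivity: `id_k ⊗ 𝓔` preserves positive semidefiniteness for every `k`. -/
def IsCompletelyPositive (E : SuperOp n) : Prop :=
  ∀ (k : ℕ) (X : Matrix (Fin k × n) (Fin k × n) ℂ), X.PosSemidef → (ampliate k E X).PosSemidef

/-- Quantum channels: completely positive trace preserving (CPTP) linear maps. -/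
def IsChannel (E : SuperOp n) : Prop :=
  IsCompletelyPositive E ∧ ∀ X : Matrix n n ℂ, (E X).trace = X.trace

/-- Unital maps: `𝓔[𝟙] = 𝟙`. -/
def IsUnital (E : SuperOp n) : Prop := E 1 = 1

/-- Unitary conjugations `ρ ↦ U ρ U†`. -/
def IsUnitaryConjugation (E : SuperOp n) : Prop :=
  ∃ U ∈ Matrix.unitaryGroup n ℂ, ∀ X : Matrix n n ℂ, E X = U * X * Uᴴ

/-- Channels that are, for every `ε > 0`, a finite product of channels at distance less than `ε`
from the identity. -/
def infinitesimalProducts : Set (SuperOp n) :=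
  {E | IsChannel E ∧ ∀ ε : ℝ, 0 < ε → ∃ l : List (SuperOp n),
    (∀ F ∈ l, IsChannel F ∧ ‖F - 1‖ < ε) ∧ E = l.prod}

/-- Infinitesimal divisibility in CPTP. -/
def IsInfinitesimalDivisible (E : SuperOp n) : Prop :=
  IsChannel E ∧ E ∈ closure (infinitesimalProducts (n := n))

/-- Generators in Lindblad form,
`L[ρ] = i [ρ, H] + ∑ i j, G i j (F i ρ (F j)† - {(F j)† F i, ρ} / 2)`
with `H` Hermitian and `G` Hermitian positive semidefinite. -/
def IsLindblad (L : SuperOp n) : Prop :=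
  ∃ (H : Matrix n n ℂ) (m : ℕ) (G : Matrix (Fin m) (Fin m) ℂ) (F : Fin m → Matrix n n ℂ),
    H.IsHermitian ∧ G.PosSemidef ∧
    ∀ X : Matrix n n ℂ, L X = Complex.I • (X * H - H * X) +
      ∑ i, ∑ j, G i j • (F i * X * (F j)ᴴ -
        (1 / 2 : ℂ) • ((F j)ᴴ * F i * X + X * ((F j)ᴴ * F i)))

/-- Non-singular channels that have at least one logarithm in Lindblad form. -/
def lindbladExponentials : Set (SuperOp n) :=
  {E | IsChannel E ∧ IsUnit E ∧ ∃ L : SuperOp n, IsLindblad L ∧ E = NormedSpace.exp L}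

/-- L-divisibility: the closure of the channels of the form `exp L`. -/
def IsLDivisible (E : SuperOp n) : Prop :=
  IsChannel E ∧ E ∈ closure (lindbladExponentials (n := n))

end General

/-- The Pauli matrices `σ₀ = 𝟙, σ₁, σ₂, σ₃`. -/
noncomputable def pauli : Fin 4 → Matrix (Fin 2) (Fin 2) ℂ :=
  ![1, !![0, 1; 1, 0], !![0, -Complex.I; Complex.I, 0], !![1, 0; 0, -1]]

/-- Pauli channels `ρ ↦ ∑ i, p i σ i ρ σ i` for a probability vector `p`. -/
def IsPauliChannel (E : SuperOp (Fin 2)) : Prop :=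
  ∃ p : Fin 4 → ℝ, (∀ i, 0 ≤ p i) ∧ ∑ i, p i = 1 ∧
    ∀ X : Matrix (Fin 2) (Fin 2) ℂ, E X = ∑ i, (p i : ℂ) • (pauli i * X * pauli i)

end QubitChannel

/-! A channel preserves the trace, so it maps the span of the three Pauli matrices to itself, by a
real matrix `M`. If `0 ≤ det M`, then `M = R₁ diag(s) R₂` with rotations `R₁`, `R₂` and `s ≥ 0`.
Rotations come from unitary conjugations (`IsRotation.exists_implements`). The channel with matrix
`diag(s)` is the exponential of a dephasing generator once `s > 0` and `s i * s j ≤ s k` for all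
distinct indices (`exists_isLindblad_exp`). Everything therefore rests on these product inequalities
and on `0 ≤ det M`.

The product inequalities follow from `AdjugateLe`: the largest stretch of `adj M` is at most the
smallest stretch of `M`. Since `adj (M N) = adj N * adj M`, this condition is stable under products.
Channels near the identity need not satisfy it: complete positivity gives only `s i + s j ≤ 1 + s
k`, which misses `s i * s j ≤ s k` by the second-order term `(1 - s i) * (1 - s j)`.

The remedy is `AdjugateBound n`, which raises the inequality between squared lengths to the power
`n` and puts `det M` on the smaller side. The determinant is multiplicative, so products of matrices
with positive determinant keep the bound, and for fixed `n` the factor `det M` absorbs the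
second-order defect near the identity (`eventually_adjugateBound`). An infinitesimal product
satisfies the bound for every `n > 0` with one fixed positive determinant; as `n` grows the
determinant becomes irrelevant and `AdjugateLe` remains. Together with `0 ≤ det` this is a closed
condition, so it passes to the closure. -/

namespace QubitChannel

/-! ### Singular values and rotations of real matrices. -/

section RealMatrices

open Matrix

/-- Singular value decomposition of a real square matrix. -/
theorem exists_svd {m : ℕ} (M : Matrix (Fin m) (Fin m) ℝ) :
    ∃ W V : Matrix (Fin m) (Fin m) ℝ, ∃ s : Fin m → ℝ, W ∈ orthogonalGroup (Fin m) ℝ ∧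
      V ∈ orthogonalGroup (Fin m) ℝ ∧ (∀ i, 0 ≤ s i) ∧ M = W * diagonal s * V := by
  have hA : (Mᵀ * M).IsHermitian := by
    simpa [conjTranspose_eq_transpose_of_trivial] using isHermitian_conjTranspose_mul_self M
  set V : Matrix (Fin m) (Fin m) ℝ := hA.eigenvectorUnitary.1
  have hVm : V ∈ orthogonalGroup (Fin m) ℝ := hA.eigenvectorUnitary.2
  have hdiag : Vᵀ * (Mᵀ * M) * V = diagonal hA.eigenvalues := by
    have h := hA.conjStarAlgAut_star_eigenvectorUnitary
    rw [Unitary.conjStarAlgAut_apply] at h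
    simpa [star_eq_conjTranspose, conjTranspose_eq_transpose_of_trivial] using h
  let f : Fin m → EuclideanSpace ℝ (Fin m) := fun i => WithLp.toLp 2 fun k => (M * V) k i
  have hf : Pairwise fun i j => inner ℝ (f i) (f j) = 0 := by
    intro i j hij
    have h : (Vᵀ * (Mᵀ * M) * V) i j = 0 := by rw [hdiag, diagonal_apply_ne _ hij]
    have h' : Vᵀ * (Mᵀ * M) * V = (M * V)ᵀ * (M * V) := by
      rw [transpose_mul]; simp only [Matrix.mul_assoc]
    rw [h', mul_apply] at h
    simpa [f, PiLp.inner_apply, mul_comm] using h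
  -- The columns of `M * V` are orthogonal but may vanish; Gram-Schmidt normalises the nonzero ones
  -- and completes them to a basis.
  let b := InnerProductSpace.gramSchmidtOrthonormalBasis (𝕜 := ℝ) (by simp) f
  let W : Matrix (Fin m) (Fin m) ℝ := of fun k i => b i k
  have hW : Wᵀ * W = 1 := by
    ext i j
    have h := b.inner_eq_ite i j
    rw [PiLp.inner_apply] at h
    simpa [W, mul_apply, one_apply, mul_comm] using h
  have hMV : M * V = W * diagonal fun i => ‖f i‖ := by
    ext k i
    rw [mul_diagonal]
    by_cases hi : f i = 0
    · have h := congrArg (fun v => v k) hi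
      simpa [f, hi] using h
    · have h := InnerProductSpace.gramSchmidtOrthonormalBasis_apply_of_orthogonal
        (𝕜 := ℝ) (by simp) hf hi
      have hk := congrArg (fun v => v k) h
      have hn : ‖f i‖ ≠ 0 := norm_ne_zero_iff.mpr hi
      simp only [W, of_apply, b]
      rw [hk]
      simp [f, field]
  have hVt : V * Vᵀ = 1 := (mem_orthogonalGroup_iff _ _).mp hVm
  refine ⟨W, Vᵀ, fun i => ‖f i‖, (mem_orthogonalGroup_iff' _ _).mpr hW,
    (mem_orthogonalGroup_iff' _ _).mpr ?_, fun i => norm_nonneg _, ?_⟩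
  · exact hVt
  · rw [← hMV, Matrix.mul_assoc, hVt, Matrix.mul_one]

/-- A proper rotation of the three-dimensional space. -/
def IsRotation (R : Matrix (Fin 3) (Fin 3) ℝ) : Prop := Rᵀ * R = 1 ∧ R.det = 1

theorem IsRotation.mul_transpose {R : Matrix (Fin 3) (Fin 3) ℝ} (h : IsRotation R) :
    R * Rᵀ = 1 := mul_eq_one_comm.mp h.1

theorem IsRotation.transpose {R : Matrix (Fin 3) (Fin 3) ℝ} (h : IsRotation R) :
    IsRotation Rᵀ := ⟨by simpa using h.mul_transpose, by rw [det_transpose, h.2]⟩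

theorem IsRotation.mul {R S : Matrix (Fin 3) (Fin 3) ℝ} (hR : IsRotation R) (hS : IsRotation S) :
    IsRotation (R * S) := by
  refine ⟨?_, by rw [det_mul, hR.2, hS.2, one_mul]⟩
  rw [transpose_mul, Matrix.mul_assoc, ← Matrix.mul_assoc Rᵀ, hR.1, Matrix.one_mul, hS.1]

theorem IsRotation.adjugate {R : Matrix (Fin 3) (Fin 3) ℝ} (h : IsRotation R) :
    R.adjugate = Rᵀ := by
  have h1 : R.adjugate * R = 1 := by rw [adjugate_mul, h.2, one_smul]
  calc R.adjugate = R.adjugate * (R * Rᵀ) := by rw [h.mul_transpose, Matrix.mul_one]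
    _ = Rᵀ := by rw [← Matrix.mul_assoc, h1, Matrix.one_mul]

/-- The rotation by `π` about a coordinate axis. -/
theorem isRotation_flip (l : Fin 3) :
    IsRotation (diagonal fun i => if i = l then 1 else -1) := by
  refine ⟨?_, ?_⟩
  · rw [diagonal_transpose, diagonal_mul_diagonal, ← diagonal_one]
    congr 1; ext i; split_ifs <;> norm_num
  · rw [det_diagonal, Fin.prod_univ_three]
    fin_cases l <;> simp

/-- The dimension is odd, so scaling by `c = det W = ±1` gives determinant `c ^ 3 * c = 1`. -/
theorem exists_isRotation_of_mem_orthogonalGroup {W : Matrix (Fin 3) (Fin 3) ℝ}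
    (hW : W ∈ orthogonalGroup (Fin 3) ℝ) :
    ∃ c : ℝ, c * c = 1 ∧ IsRotation (c • W) := by
  have h1 : Wᵀ * W = 1 := by
    exact (mem_orthogonalGroup_iff' _ _).mp hW
  have hd : W.det * W.det = 1 := by
    have := congrArg det h1
    simpa using this
  refine ⟨W.det, hd, ?_, ?_⟩
  · rw [transpose_smul, smul_mul_smul_comm, hd, h1, one_smul]
  · rw [det_smul, Fintype.card_fin]
    linear_combination (W.det * W.det + 1) * hd

/-- A real `3 × 3` matrix of nonnegative determinant is, up to rotations, diagonal with
nonnegative entries. -/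
theorem exists_rotation_svd {M : Matrix (Fin 3) (Fin 3) ℝ} (hM : 0 ≤ M.det) :
    ∃ R₁ R₂ : Matrix (Fin 3) (Fin 3) ℝ, ∃ s : Fin 3 → ℝ, IsRotation R₁ ∧ IsRotation R₂ ∧
      (∀ i, 0 ≤ s i) ∧ M = R₁ * diagonal s * R₂ := by
  obtain ⟨W, V, s, hW, hV, hs, h⟩ := exists_svd M
  obtain ⟨a, ha, hWr⟩ := exists_isRotation_of_mem_orthogonalGroup hW
  obtain ⟨b, hb, hVr⟩ := exists_isRotation_of_mem_orthogonalGroup hV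
  have hMab : M = (a • W) * ((a * b) • diagonal s) * (b • V) := by
    rw [h]
    rw [smul_mul_smul_comm, smul_mul_smul_comm,
      show a * (a * b) * b = 1 by linear_combination (a * a) * hb + ha, one_smul]
  have hab : (a * b) * (a * b) = 1 := by linear_combination (a * a) * hb + ha
  have hcase : a * b = 1 ∨ a * b = -1 := mul_self_eq_one_iff.mp hab
  rcases hcase with h1 | h1
  · exact ⟨_, _, s, hWr, hVr, hs, by rw [hMab, h1, one_smul]⟩
  · have hdet : M.det = -∏ i, s i := by
      rw [hMab, det_mul, det_mul, hWr.2, hVr.2, h1, neg_one_smul, det_neg, det_diagonal]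
      simp; norm_num
    -- With the wrong sign, `0 ≤ det M` forces some `s l = 0`; then `-diagonal s` is a rotation by
    -- `π` about axis `l` times `diagonal s`.
    have hp : ∏ i, s i = 0 :=
      le_antisymm (by linarith) (Finset.prod_nonneg fun i _ => hs i)
    obtain ⟨l, -, hl⟩ := Finset.prod_eq_zero_iff.mp hp
    refine ⟨_, _, s, hWr.mul (isRotation_flip l), hVr, hs, ?_⟩
    rw [hMab, h1, Matrix.mul_assoc (a • W) (diagonal _) (diagonal s), diagonal_mul_diagonal, neg_one_smul, diagonal_neg]
    congr 3
    ext i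
    by_cases hi : i = l
    · subst hi; simp [hl]
    · simp [hi]

/-! ### The adjugate inequality with a determinant factor. -/

/-- `M` expands the lengths of vectors at least as much as its adjugate does, up to a power of the
determinant. -/
def AdjugateBound (n : ℕ) (M : Matrix (Fin 3) (Fin 3) ℝ) : Prop :=
  ∀ u w : Fin 3 → ℝ,
    M.det * (((M.adjugate *ᵥ u) ⬝ᵥ (M.adjugate *ᵥ u)) * (w ⬝ᵥ w)) ^ n ≤
      (((M *ᵥ w) ⬝ᵥ (M *ᵥ w)) * (u ⬝ᵥ u)) ^ n

/-- The bound for `N` at `(adj M u, w)` chains with the bound for `M` at `(u, N w)`. -/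
theorem AdjugateBound.mul {n : ℕ} {M N : Matrix (Fin 3) (Fin 3) ℝ} (hM : AdjugateBound n M)
    (hN : AdjugateBound n N) (hd : 0 ≤ M.det) : AdjugateBound n (M * N) := by
  intro u w
  have h1 := mul_le_mul_of_nonneg_left (hN (M.adjugate *ᵥ u) w) hd
  have h2 := hM u (N *ᵥ w)
  rw [det_mul, adjugate_mul_distrib, ← mulVec_mulVec, ← mulVec_mulVec, mul_assoc]
  refine h1.trans (le_trans (le_of_eq ?_) h2)
  rw [mul_comm ((N *ᵥ w) ⬝ᵥ _)]

theorem dotProduct_mulVec_self_of_transpose_mul {R : Matrix (Fin 3) (Fin 3) ℝ} (h : Rᵀ * R = 1)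
    (v : Fin 3 → ℝ) : (R *ᵥ v) ⬝ᵥ (R *ᵥ v) = v ⬝ᵥ v := by
  rw [dotProduct_mulVec, ← mulVec_transpose, mulVec_mulVec, h, one_mulVec]

theorem IsRotation.adjugateBound {R : Matrix (Fin 3) (Fin 3) ℝ} (h : IsRotation R) (n : ℕ) :
    AdjugateBound n R := by
  intro u w
  rw [h.adjugate, h.2, one_mul, dotProduct_mulVec_self_of_transpose_mul h.1,
    dotProduct_mulVec_self_of_transpose_mul h.transpose.1, mul_comm]

theorem isRotation_one : IsRotation 1 := ⟨by simp, by simp⟩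

theorem adjugateBound_list_prod {n : ℕ} (l : List (Matrix (Fin 3) (Fin 3) ℝ))
    (h : ∀ M ∈ l, AdjugateBound n M ∧ 0 < M.det) :
    AdjugateBound n l.prod ∧ 0 < l.prod.det := by
  induction l with
  | nil => exact ⟨isRotation_one.adjugateBound n, by simp⟩
  | cons M l ih =>
    have h1 := h M (by simp)
    have h2 := ih fun N hN => h N (by simp [hN])
    rw [List.prod_cons, det_mul]
    exact ⟨h1.1.mul h2.1 h1.2.le, mul_pos h1.2 h2.2⟩

/-- Otherwise `(b / a) ^ n` would eventually drop below `d`. -/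
theorem le_of_forall_mul_pow_le {d a b : ℝ} (hd : 0 < d) (hb : 0 ≤ b)
    (h : ∀ n : ℕ, d * a ^ n ≤ b ^ n) : a ≤ b := by
  by_contra! hab
  have ha : 0 < a := hb.trans_lt hab
  obtain ⟨n, hn⟩ := exists_pow_lt_of_lt_one hd ((div_lt_one ha).mpr hab)
  rw [div_pow, div_lt_iff₀ (pow_pos ha n)] at hn
  exact absurd (h n) (not_le.mpr hn)

/-- The scalar estimate behind `AdjugateBound` for channels close to the identity. -/
theorem mul_pow_le_pow_of_close {n : ℕ} {a b c : ℝ} (hn : 0 < n) (ha : 1 / 2 ≤ a)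
    (hb : 1 / 2 ≤ b) (ha1 : a ≤ 1) (hb1 : b ≤ 1) (hna : n * (1 - a) ≤ 1 / 4)
    (hc : a + b ≤ 1 + c) : b * (a * b) ^ n ≤ c ^ n := by
  have hab : 1 / 4 ≤ a * b := by nlinarith
  have hab0 : 0 < a * b := by linarith
  -- Chosen so that `(1 - x) * (a * b) = a + b - 1 ≤ c`. By Bernoulli the loss `(1 - x) ^ n` is at
  -- least `1 - n * x ≥ b`.
  set x := (1 - a) * (1 - b) / (a * b) with hx
  have hx0 : 0 ≤ x := by
    rw [hx]; exact div_nonneg (mul_nonneg (by linarith) (by linarith)) hab0.le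
  have hxab : x * (a * b) = (1 - a) * (1 - b) := by rw [hx]; field_simp
  have hnx : n * x ≤ 1 - b := by
    rw [hx, ← mul_div_assoc, div_le_iff₀ hab0]
    have := mul_le_mul_of_nonneg_right hna (by linarith : 0 ≤ 1 - b)
    nlinarith
  have hn1 : (1 : ℝ) ≤ n := by exact_mod_cast hn
  have hx1 : x ≤ 1 := by nlinarith
  have hbern : 1 - n * x ≤ (1 - x) ^ n := by
    have := one_add_mul_le_pow (a := -x) (by linarith) n
    calc 1 - n * x = 1 + n * -x := by ring
      _ ≤ (1 + -x) ^ n := this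
      _ = (1 - x) ^ n := by ring
  calc b * (a * b) ^ n ≤ (1 - x) ^ n * (a * b) ^ n := by
        apply mul_le_mul_of_nonneg_right _ (pow_nonneg hab0.le n); linarith
    _ = ((1 - x) * (a * b)) ^ n := (mul_pow _ _ _).symm
    _ ≤ c ^ n := by
        apply pow_le_pow_left₀ (mul_nonneg (by linarith) hab0.le)
        nlinarith

theorem exists_le_dotProduct_diagonal_mulVec (d : Fin 3 → ℝ) :
    ∃ k, ∀ v : Fin 3 → ℝ, d k ^ 2 * (v ⬝ᵥ v) ≤ (diagonal d *ᵥ v) ⬝ᵥ (diagonal d *ᵥ v) := by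
  obtain ⟨k, hk⟩ := Finite.exists_min fun i => d i ^ 2
  refine ⟨k, fun v => ?_⟩
  simp only [dotProduct, Finset.mul_sum, mulVec_diagonal]
  refine Finset.sum_le_sum fun i _ => ?_
  have := mul_le_mul_of_nonneg_right (hk i) (mul_self_nonneg (v i))
  linarith

theorem exists_dotProduct_diagonal_mulVec_le (d : Fin 3 → ℝ) :
    ∃ k, ∀ v : Fin 3 → ℝ, (diagonal d *ᵥ v) ⬝ᵥ (diagonal d *ᵥ v) ≤ d k ^ 2 * (v ⬝ᵥ v) := by
  obtain ⟨k, hk⟩ := Finite.exists_max fun i => d i ^ 2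
  refine ⟨k, fun v => ?_⟩
  simp only [dotProduct, Finset.mul_sum, mulVec_diagonal]
  refine Finset.sum_le_sum fun i _ => ?_
  have := mul_le_mul_of_nonneg_right (hk i) (mul_self_nonneg (v i))
  linarith

theorem adjugate_diagonal_fin_three (s : Fin 3 → ℝ) :
    (diagonal s).adjugate = diagonal ![s 1 * s 2, s 0 * s 2, s 0 * s 1] := by
  ext i j
  fin_cases i <;> fin_cases j <;> simp [adjugate_fin_three, -adjugate_diagonal]

theorem adjugateBound_diagonal {n : ℕ} {s : Fin 3 → ℝ} (hs : ∀ i, 0 ≤ s i)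
    (h : ∀ l k, s 0 * s 1 * s 2 * (![s 1 * s 2, s 0 * s 2, s 0 * s 1] l) ^ (2 * n) ≤
      s k ^ (2 * n)) : AdjugateBound n (diagonal s) := by
  intro u w
  rw [adjugate_diagonal_fin_three, det_diagonal, Fin.prod_univ_three]
  set d := ![s 1 * s 2, s 0 * s 2, s 0 * s 1]
  obtain ⟨l, hl⟩ := exists_dotProduct_diagonal_mulVec_le d
  obtain ⟨k, hk⟩ := exists_le_dotProduct_diagonal_mulVec s
  have hu : 0 ≤ u ⬝ᵥ u := Finset.sum_nonneg fun i _ => mul_self_nonneg _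
  have hw : 0 ≤ w ⬝ᵥ w := Finset.sum_nonneg fun i _ => mul_self_nonneg _
  have hdu : 0 ≤ (diagonal d *ᵥ u) ⬝ᵥ (diagonal d *ᵥ u) :=
    Finset.sum_nonneg fun i _ => mul_self_nonneg _
  have hs0 : 0 ≤ s 0 * s 1 * s 2 := mul_nonneg (mul_nonneg (hs 0) (hs 1)) (hs 2)
  have huw : 0 ≤ ((u ⬝ᵥ u) * (w ⬝ᵥ w)) ^ n := pow_nonneg (mul_nonneg hu hw) n
  calc s 0 * s 1 * s 2 * (((diagonal d *ᵥ u) ⬝ᵥ (diagonal d *ᵥ u)) * (w ⬝ᵥ w)) ^ n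
      ≤ s 0 * s 1 * s 2 * ((d l ^ 2 * (u ⬝ᵥ u)) * (w ⬝ᵥ w)) ^ n := by
        gcongr; exact hl u
    _ = (s 0 * s 1 * s 2 * d l ^ (2 * n)) * ((u ⬝ᵥ u) * (w ⬝ᵥ w)) ^ n := by
        rw [pow_mul, mul_assoc (d l ^ 2), mul_pow (d l ^ 2)]; ring
    _ ≤ s k ^ (2 * n) * ((u ⬝ᵥ u) * (w ⬝ᵥ w)) ^ n :=
        mul_le_mul_of_nonneg_right (h l k) huw
    _ = ((s k ^ 2 * (w ⬝ᵥ w)) * (u ⬝ᵥ u)) ^ n := by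
        rw [pow_mul, ← mul_pow]; ring
    _ ≤ (((diagonal s *ᵥ w) ⬝ᵥ (diagonal s *ᵥ w)) * (u ⬝ᵥ u)) ^ n := by
        gcongr; exact hk w

/-- If `k` is one of the two indices in the adjugate entry, all factors being at most `1` suffices.
Only the complementary index needs the scalar estimate, after bounding the determinant by one of the
two factors. The exponent `2 * n` reflects squared lengths. -/
theorem adjugateBound_diagonal_of_close {n : ℕ} (hn : 0 < n) {s : Fin 3 → ℝ}
    (hlow : ∀ i, 1 / 2 ≤ s i) (hone : ∀ i, s i ≤ 1)
    (hclose : ∀ i, ((2 * n : ℕ) : ℝ) * (1 - s i) ≤ 1 / 4)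
    (h0 : s 1 + s 2 ≤ 1 + s 0) (h1 : s 0 + s 2 ≤ 1 + s 1) (h2 : s 0 + s 1 ≤ 1 + s 2) :
    AdjugateBound n (diagonal s) := by
  have hpos : ∀ i, 0 ≤ s i := fun i => by linarith [hlow i]
  have hdet (i j k : Fin 3) : s i * s j * s k ≤ s j := by
    nlinarith [mul_le_one₀ (hone i) (hpos k) (hone k), hpos j]
  have hne (i j : Fin 3) (e : ℝ) (he : e = s i * s j) :
      s 0 * s 1 * s 2 * e ^ (2 * n) ≤ s i ^ (2 * n) ∧
      s 0 * s 1 * s 2 * e ^ (2 * n) ≤ s j ^ (2 * n) := by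
    have hd : s 0 * s 1 * s 2 ≤ 1 := (hdet 0 1 2).trans (hone 1)
    have he0 : 0 ≤ e ^ (2 * n) := by rw [he]; exact pow_nonneg (mul_nonneg (hpos i) (hpos j)) _
    have hde : s 0 * s 1 * s 2 * e ^ (2 * n) ≤ e ^ (2 * n) := mul_le_of_le_one_left he0 hd
    constructor
    · refine hde.trans (pow_le_pow_left₀ (by rw [he]; exact mul_nonneg (hpos i) (hpos j)) ?_ _)
      rw [he]; exact mul_le_of_le_one_right (hpos i) (hone j)
    · refine hde.trans (pow_le_pow_left₀ (by rw [he]; exact mul_nonneg (hpos i) (hpos j)) ?_ _)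
      rw [he]; exact mul_le_of_le_one_left (hpos j) (hone i)
  have heq (i j k : Fin 3) (hd : s 0 * s 1 * s 2 = s i * s j * s k) (h : s i + s j ≤ 1 + s k) :
      s 0 * s 1 * s 2 * (s i * s j) ^ (2 * n) ≤ s k ^ (2 * n) := by
    refine le_trans ?_ (mul_pow_le_pow_of_close (by omega) (hlow i) (hlow j) (hone i) (hone j)
      (hclose i) h)
    rw [hd]
    exact mul_le_mul_of_nonneg_right (hdet i j k)
      (pow_nonneg (mul_nonneg (hpos i) (hpos j)) _)
  refine adjugateBound_diagonal hpos fun l k => ?_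
  fin_cases l <;> fin_cases k
  · exact heq 1 2 0 (by ring) h0
  · exact (hne 1 2 _ rfl).1
  · exact (hne 1 2 _ rfl).2
  · exact (hne 0 2 _ rfl).1
  · exact heq 0 2 1 (by ring) h1
  · exact (hne 0 2 _ rfl).2
  · exact (hne 0 1 _ rfl).1
  · exact (hne 0 1 _ rfl).2
  · exact heq 0 1 2 (by ring) h2

/-! ### Complete positivity and matrices near the identity. -/

/-- The constraint that complete positivity puts on the linear part of the action of a channel on
the Bloch ball. -/
def RotationTraceBound (M : Matrix (Fin 3) (Fin 3) ℝ) : Prop :=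
  ∀ R, IsRotation R → 0 ≤ 1 + (Rᵀ * M).trace

/-- Testing against `R₁ * F * R₂`, with `F` the rotation by `π` about axis `l`, leaves the signed
sum of the `s i` with a plus sign only at `l`. -/
theorem RotationTraceBound.le_diagonal {R₁ R₂ : Matrix (Fin 3) (Fin 3) ℝ} {s : Fin 3 → ℝ}
    (h₁ : IsRotation R₁) (h₂ : IsRotation R₂)
    (h : RotationTraceBound (R₁ * diagonal s * R₂)) :
    s 1 + s 2 ≤ 1 + s 0 ∧ s 0 + s 2 ≤ 1 + s 1 ∧ s 0 + s 1 ≤ 1 + s 2 := by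
  have key (l : Fin 3) : 0 ≤ 1 + ∑ i, (if i = l then 1 else -1) * s i := by
    have hR := h _ ((h₁.mul (isRotation_flip l)).mul h₂)
    have hcomp : ((R₁ * diagonal fun i => if i = l then (1 : ℝ) else -1) * R₂)ᵀ *
        (R₁ * diagonal s * R₂) =
        R₂ᵀ * (diagonal (fun i => if i = l then (1 : ℝ) else -1) * (R₁ᵀ * R₁) * diagonal s * R₂) :=
      by simp only [transpose_mul, diagonal_transpose, Matrix.mul_assoc]
    rw [hcomp, h₁.1, Matrix.mul_one, trace_mul_comm, Matrix.mul_assoc, h₂.mul_transpose,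
      Matrix.mul_one, diagonal_mul_diagonal, trace_diagonal] at hR
    exact hR
  have k0 := key 0
  have k1 := key 1
  have k2 := key 2
  simp [Fin.sum_univ_three] at k0 k1 k2
  exact ⟨by linarith, by linarith, by linarith⟩

/-- Continuity of singular values is avoided: `(Mᵀ * M).trace` is the sum of the `s i ^ 2`, and as
each `s i ≤ 1`, a trace near `3` forces every `s i` near `1`. The margin `1 / (8 * n)` yields the `1
/ 4` of the scalar estimate at exponent `2 * n`. -/
theorem eventually_adjugateBound {n : ℕ} (hn : 0 < n) :
    ∀ᶠ M in nhds (1 : Matrix (Fin 3) (Fin 3) ℝ),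
      RotationTraceBound M → AdjugateBound n M ∧ 0 < M.det := by
  have hn0 : (1 : ℝ) ≤ n := by exact_mod_cast hn
  have hdet : ∀ᶠ M in nhds (1 : Matrix (Fin 3) (Fin 3) ℝ), 0 < M.det := by
    have hc : Continuous fun M : Matrix (Fin 3) (Fin 3) ℝ => M.det := by fun_prop
    exact hc.continuousAt.eventually (lt_mem_nhds (by simp))
  have htr : ∀ᶠ M in nhds (1 : Matrix (Fin 3) (Fin 3) ℝ),
      3 - 1 / (8 * n : ℝ) < (Mᵀ * M).trace := by
    have hc : Continuous fun M : Matrix (Fin 3) (Fin 3) ℝ => (Mᵀ * M).trace := by fun_prop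
    refine hc.continuousAt.eventually (lt_mem_nhds ?_)
    have : 0 < 1 / (8 * n : ℝ) := by positivity
    simp
    linarith
  filter_upwards [hdet, htr] with M hM1 hM2 hM
  refine ⟨?_, hM1⟩
  obtain ⟨R₁, R₂, s, h₁, h₂, hs, rfl⟩ := exists_rotation_svd hM1.le
  obtain ⟨b0, b1, b2⟩ := hM.le_diagonal h₁ h₂
  have htr2 : ((R₁ * diagonal s * R₂)ᵀ * (R₁ * diagonal s * R₂)).trace =
      s 0 * s 0 + s 1 * s 1 + s 2 * s 2 := by
    have hcomp : (R₁ * diagonal s * R₂)ᵀ * (R₁ * diagonal s * R₂) =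
        R₂ᵀ * (diagonal s * (R₁ᵀ * R₁) * diagonal s * R₂) := by
      simp only [transpose_mul, diagonal_transpose, Matrix.mul_assoc]
    rw [hcomp, h₁.1, Matrix.mul_one, trace_mul_comm, Matrix.mul_assoc, h₂.mul_transpose,
      Matrix.mul_one, diagonal_mul_diagonal, trace_diagonal, Fin.sum_univ_three]
  rw [htr2] at hM2
  -- Adding two of the three inequalities `b0`, `b1`, `b2` gives each bound.
  have hone : ∀ i, s i ≤ 1 := by
    intro i; fin_cases i <;> dsimp <;> linarith
  have hsq (i : Fin 3) : s i * s i ≤ s i := mul_le_of_le_one_left (hs i) (hone i)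
  have hclose : ∀ i, 1 - s i ≤ 1 / (8 * n : ℝ) := by
    have := hsq 0; have := hsq 1; have := hsq 2
    have := hone 0; have := hone 1; have := hone 2
    intro i; fin_cases i <;> dsimp <;> linarith
  have hη : 1 / (8 * n : ℝ) ≤ 1 / 8 := by
    apply one_div_le_one_div_of_le <;> linarith
  have hd : 0 ≤ (diagonal s).det := by
    rw [det_diagonal]; exact Finset.prod_nonneg fun i _ => hs i
  have hdiag : AdjugateBound n (diagonal s) := by
    refine adjugateBound_diagonal_of_close hn (fun i => by linarith [hclose i]) hone
      (fun i => ?_) b0 b1 b2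
    calc ((2 * n : ℕ) : ℝ) * (1 - s i) ≤ ((2 * n : ℕ) : ℝ) * (1 / (8 * n : ℝ)) :=
          mul_le_mul_of_nonneg_left (hclose i) (Nat.cast_nonneg _)
      _ = 1 / 4 := by push_cast; field_simp; norm_num
  have h1' := (h₁.adjugateBound n).mul hdiag (by rw [h₁.2]; exact zero_le_one)
  refine h1'.mul (h₂.adjugateBound n) ?_
  rw [det_mul, h₁.2, one_mul]; exact hd

/-- The closed condition satisfied by the linear parts of infinitesimal divisible channels. -/
def AdjugateLe (M : Matrix (Fin 3) (Fin 3) ℝ) : Prop :=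
  ∀ u w : Fin 3 → ℝ,
    ((M.adjugate *ᵥ u) ⬝ᵥ (M.adjugate *ᵥ u)) * (w ⬝ᵥ w) ≤ ((M *ᵥ w) ⬝ᵥ (M *ᵥ w)) * (u ⬝ᵥ u)

theorem isClosed_adjugateLe_and_det_nonneg :
    IsClosed {M : Matrix (Fin 3) (Fin 3) ℝ | AdjugateLe M ∧ 0 ≤ M.det} := by
  have hc : Continuous fun M : Matrix (Fin 3) (Fin 3) ℝ => M.det := by fun_prop
  have hset : {M : Matrix (Fin 3) (Fin 3) ℝ | AdjugateLe M} = ⋂ u : Fin 3 → ℝ, ⋂ w : Fin 3 → ℝ,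
      {M | ((M.adjugate *ᵥ u) ⬝ᵥ (M.adjugate *ᵥ u)) * (w ⬝ᵥ w) ≤
        ((M *ᵥ w) ⬝ᵥ (M *ᵥ w)) * (u ⬝ᵥ u)} := by
    ext M; simp [AdjugateLe]
  have h1 : IsClosed {M : Matrix (Fin 3) (Fin 3) ℝ | AdjugateLe M} := by
    rw [hset]
    exact isClosed_iInter fun u => isClosed_iInter fun w => isClosed_le (by fun_prop) (by fun_prop)
  exact h1.inter (isClosed_le continuous_const hc)

theorem adjugateLe_of_forall_adjugateBound {M : Matrix (Fin 3) (Fin 3) ℝ} (hd : 0 < M.det)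
    (h : ∀ n, 0 < n → AdjugateBound n M) : AdjugateLe M := by
  intro u w
  set a := ((M.adjugate *ᵥ u) ⬝ᵥ (M.adjugate *ᵥ u)) * (w ⬝ᵥ w)
  have hb : 0 ≤ ((M *ᵥ w) ⬝ᵥ (M *ᵥ w)) * (u ⬝ᵥ u) :=
    mul_nonneg (Finset.sum_nonneg fun i _ => mul_self_nonneg _)
      (Finset.sum_nonneg fun i _ => mul_self_nonneg _)
  -- Capping the determinant at `1` makes the case `n = 0` trivial, where no bound is assumed.
  have hd1 : 0 < min M.det 1 := lt_min hd one_pos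
  have ha : 0 ≤ a := mul_nonneg (Finset.sum_nonneg fun i _ => mul_self_nonneg _)
      (Finset.sum_nonneg fun i _ => mul_self_nonneg _)
  refine le_of_forall_mul_pow_le hd1 hb fun n => ?_
  rcases Nat.eq_zero_or_pos n with rfl | hn
  · simp
  · exact (mul_le_mul_of_nonneg_right (min_le_left _ _) (pow_nonneg ha n)).trans (h n hn u w)

/-- Evaluate at singular vectors: `R₁` carries the `l`-th axis and `R₂ᵀ` the `k`-th. -/
theorem AdjugateLe.le_diagonal {R₁ R₂ : Matrix (Fin 3) (Fin 3) ℝ} {s : Fin 3 → ℝ}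
    (h₁ : IsRotation R₁) (h₂ : IsRotation R₂) (hs : ∀ i, 0 ≤ s i)
    (h : AdjugateLe (R₁ * diagonal s * R₂)) (l k : Fin 3) :
    ![s 1 * s 2, s 0 * s 2, s 0 * s 1] l ≤ s k := by
  have hlk := h (R₁ *ᵥ Pi.single l 1) (R₂ᵀ *ᵥ Pi.single k 1)
  rw [adjugate_mul_distrib, adjugate_mul_distrib, h₁.adjugate, h₂.adjugate,
    adjugate_diagonal_fin_three, mulVec_mulVec, mulVec_mulVec,
    show R₂ᵀ * (diagonal ![s 1 * s 2, s 0 * s 2, s 0 * s 1] * R₁ᵀ) * R₁ =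
      R₂ᵀ * (diagonal ![s 1 * s 2, s 0 * s 2, s 0 * s 1] * (R₁ᵀ * R₁)) by
        simp only [Matrix.mul_assoc],
    Matrix.mul_assoc (R₁ * diagonal s), h₁.1, h₂.mul_transpose, Matrix.mul_one, Matrix.mul_one,
    ← mulVec_mulVec, ← mulVec_mulVec] at hlk
  simp only [dotProduct_mulVec_self_of_transpose_mul h₁.1,
    dotProduct_mulVec_self_of_transpose_mul h₂.transpose.1] at hlk
  simp at hlk
  exact abs_le_of_sq_le_sq' (by simpa [sq] using hlk) (hs k) |>.2

end RealMatrices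

/-! ### Channels in Pauli coordinates. -/

section Bloch

open Matrix

theorem pauli_isHermitian (i : Fin 4) : (pauli i)ᴴ = pauli i := by
  fin_cases i <;> ext a b <;> fin_cases a <;> fin_cases b <;> simp [pauli]

theorem pauli_mul_self (i : Fin 4) : pauli i * pauli i = 1 := by
  fin_cases i <;> ext a b <;> fin_cases a <;> fin_cases b <;> simp [pauli]

theorem pauli_succ_trace (j : Fin 3) : (pauli j.succ).trace = 0 := by
  fin_cases j <;> simp [pauli, trace_fin_two]

theorem trace_pauli_mul_pauli (i j : Fin 4) :
    (pauli i * pauli j).trace = if i = j then 2 else 0 := by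
  fin_cases i <;> fin_cases j <;> simp [pauli, trace_fin_two] <;> norm_num

theorem pauli_expansion (X : Matrix (Fin 2) (Fin 2) ℂ) :
    X = (X.trace / 2) • (1 : Matrix (Fin 2) (Fin 2) ℂ) +
      ∑ k : Fin 3, ((pauli k.succ * X).trace / 2) • pauli k.succ := by
  ext a b
  fin_cases a <;> fin_cases b <;>
    simp [pauli, trace_fin_two, Fin.sum_univ_three, mul_apply, Fin.sum_univ_two,
      Matrix.add_apply] <;> ring_nf <;> simp <;> ring

/-- Two linear maps that agree on the Pauli matrices are equal. -/
theorem superOp_ext {E F : SuperOp (Fin 2)} (h : ∀ i, E (pauli i) = F (pauli i)) : E = F := by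
  have h1 : E 1 = F 1 := h 0
  ext1 X
  rw [pauli_expansion X]
  simp [h, h1]

/-- `E` maps the span of `σ₁, σ₂, σ₃` to itself, acting on it by the real matrix `M`. -/
def HasBlochMatrix (E : SuperOp (Fin 2)) (M : Matrix (Fin 3) (Fin 3) ℝ) : Prop :=
  ∀ j : Fin 3, E (pauli j.succ) = ∑ k : Fin 3, (M k j : ℂ) • pauli k.succ

/-- The value at the identity plays no role, so non-unital factors are allowed. -/
theorem HasBlochMatrix.mul {E F : SuperOp (Fin 2)} {M N : Matrix (Fin 3) (Fin 3) ℝ}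
    (hE : HasBlochMatrix E M) (hF : HasBlochMatrix F N) : HasBlochMatrix (E * F) (M * N) := by
  intro j
  rw [mul_apply_eq_comp, hF j, map_sum]
  simp only [map_smul, hE _, Finset.smul_sum, smul_smul]
  rw [Finset.sum_comm]
  refine Finset.sum_congr rfl fun k _ => ?_
  rw [← Finset.sum_smul, mul_apply]
  push_cast
  congr 1
  exact Finset.sum_congr rfl fun i _ => mul_comm _ _

theorem hasBlochMatrix_one : HasBlochMatrix 1 1 := by
  intro j
  simp [one_apply]

theorem HasBlochMatrix.ext {E F : SuperOp (Fin 2)} {M : Matrix (Fin 3) (Fin 3) ℝ}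
    (hE : HasBlochMatrix E M) (hF : HasBlochMatrix F M) (h : E 1 = F 1) : E = F := by
  refine superOp_ext fun i => ?_
  cases i using Fin.cases with
  | zero => exact h
  | succ j => rw [hE, hF]

/-- The action of a linear map on the span of `σ₁, σ₂, σ₃`, in real coordinates. -/
noncomputable def blochMatrix (E : SuperOp (Fin 2)) : Matrix (Fin 3) (Fin 3) ℝ :=
  of fun k j => ((pauli k.succ * E (pauli j.succ)).trace / 2).re

theorem continuous_blochMatrix : Continuous blochMatrix := by
  refine continuous_matrix fun k j => ?_
  have h : Continuous fun E : SuperOp (Fin 2) => E (pauli j.succ) := by fun_prop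
  have h2 : Continuous fun X : Matrix (Fin 2) (Fin 2) ℂ => (pauli k.succ * X).trace := by fun_prop
  exact Complex.continuous_re.comp ((h2.comp h).div_const 2)

theorem HasBlochMatrix.blochMatrix_eq {E : SuperOp (Fin 2)} {M : Matrix (Fin 3) (Fin 3) ℝ}
    (h : HasBlochMatrix E M) : blochMatrix E = M := by
  ext k j
  simp [blochMatrix, h j, Matrix.mul_sum, trace_sum, trace_pauli_mul_pauli]

theorem posSemidef_one_add_pauli (i : Fin 4) : (1 + pauli i).PosSemidef := by
  have h : (1 + pauli i) = (1 / 2 : ℂ) • ((1 + pauli i)ᴴ * (1 + pauli i)) := by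
    rw [conjTranspose_add, conjTranspose_one, pauli_isHermitian, add_mul, mul_add, mul_add,
      pauli_mul_self]
    simp only [Matrix.mul_one, Matrix.one_mul]
    module
  rw [h]
  exact (posSemidef_conjTranspose_mul_self _).smul (by simp)

theorem IsCompletelyPositive.posSemidef {n : Type} [Fintype n] [DecidableEq n] {E : SuperOp n}
    (hE : IsCompletelyPositive E) {X : Matrix n n ℂ} (hX : X.PosSemidef) : (E X).PosSemidef := by
  have h := (hE 1 (X.submatrix Prod.snd Prod.snd) (hX.submatrix _)).submatrix
    (fun a : n => ((0 : Fin 1), a))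
  exact h

/-- `pauli i` is the difference of the positive matrices `1 + pauli i` and `1`. -/
theorem IsChannel.isHermitian_pauli {E : SuperOp (Fin 2)} (hE : IsChannel E) (i : Fin 4) :
    (E (pauli i)).IsHermitian := by
  have h1 := (hE.1.posSemidef (posSemidef_one_add_pauli i)).isHermitian
  have h2 := (hE.1.posSemidef (PosSemidef.one (n := Fin 2) (R := ℂ))).isHermitian
  have h3 := h1.sub h2
  rwa [map_add, add_sub_cancel_left] at h3

theorem IsChannel.hasBlochMatrix {E : SuperOp (Fin 2)} (hE : IsChannel E) :
    HasBlochMatrix E (blochMatrix E) := by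
  intro j
  conv_lhs => rw [pauli_expansion (E (pauli j.succ))]
  rw [hE.2, pauli_succ_trace, zero_div, zero_smul, zero_add]
  refine Finset.sum_congr rfl fun k _ => ?_
  congr 1
  simp only [blochMatrix, of_apply]
  refine (Complex.conj_eq_iff_re.mp ?_).symm
  have h := hE.isHermitian_pauli j.succ
  rw [map_div₀, starRingEnd_apply, ← trace_conjTranspose, conjTranspose_mul, h.eq,
    pauli_isHermitian, trace_mul_comm]
  exact congrArg _ (Complex.conj_ofNat 2)

/-- Evaluating the Choi matrix of a channel on the maximally entangled vector of a unitary. -/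
theorem IsChannel.trace_nonneg {E : SuperOp (Fin 2)} (hE : IsChannel E)
    (U : Matrix (Fin 2) (Fin 2) ℂ) :
    0 ≤ (∑ a, ∑ b, (Uᴴ * E (single a b 1) * U) a b) := by
  -- The unnormalised maximally entangled vector: the blocks of its projector are the matrix units.
  let v : Fin 2 × Fin 2 → ℂ := fun p => if p.1 = p.2 then 1 else 0
  have h := (hE.1 2 _ (posSemidef_vecMulVec_self_star v)).dotProduct_mulVec_nonneg
    fun p => U p.2 p.1
  have hs (p q : Fin 2) :
      (of fun a b => vecMulVec v (star v) (p, a) (q, b)) = single p q (1 : ℂ) := by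
    ext a b
    simp [v, vecMulVec_apply, single_apply, ite_and]
    split_ifs <;> rfl
  refine h.trans_eq ?_
  simp only [ampliate, hs, dotProduct, mulVec, Fintype.sum_prod_type, of_apply, mul_apply,
    Fin.sum_univ_two, conjTranspose_apply, Pi.star_apply]
  ring

theorem single_eq_pauli : single 0 0 (1 : ℂ) = (1 / 2 : ℂ) • (pauli 0 + pauli 3) ∧
    single 0 1 (1 : ℂ) = (1 / 2 : ℂ) • (pauli 1 + Complex.I • pauli 2) ∧
    single 1 0 (1 : ℂ) = (1 / 2 : ℂ) • (pauli 1 - Complex.I • pauli 2) ∧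
    single 1 1 (1 : ℂ) = (1 / 2 : ℂ) • (pauli 0 - pauli 3) := by
  refine ⟨?_, ?_, ?_, ?_⟩ <;> ext a b <;> fin_cases a <;> fin_cases b <;>
    simp [pauli] <;> norm_num

theorem sum_trace_pauli_mul (A : Fin 4 → Matrix (Fin 2) (Fin 2) ℂ) :
    ∑ i, (pauli i * A i).trace = A 0 0 0 + A 0 1 1 + (A 1 0 1 + A 1 1 0) +
      Complex.I * (A 2 0 1 - A 2 1 0) + (A 3 0 0 - A 3 1 1) := by
  simp [Fin.sum_univ_four, trace_fin_two, mul_apply, Fin.sum_univ_two, pauli]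
  ring

/-- Matrix units and Pauli matrices divided by `√2` are both Hilbert–Schmidt orthonormal bases, so
the Choi expression is half of this sum. -/
theorem IsChannel.sum_trace_nonneg {E : SuperOp (Fin 2)} (hE : IsChannel E)
    (U : Matrix (Fin 2) (Fin 2) ℂ) :
    0 ≤ ∑ i, (U * pauli i * Uᴴ * E (pauli i)).trace := by
  have h := hE.trace_nonneg U
  obtain ⟨h00, h01, h10, h11⟩ := single_eq_pauli
  have htr (i : Fin 4) : (U * pauli i * Uᴴ * E (pauli i)).trace =
      (pauli i * (Uᴴ * E (pauli i) * U)).trace := by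
    rw [Matrix.mul_assoc, Matrix.mul_assoc, trace_mul_comm]
    simp only [Matrix.mul_assoc]
  simp only [htr]
  simp only [Fin.sum_univ_two, h00, h01, h10, h11, map_smul, map_add, map_sub, Matrix.mul_smul,
    Matrix.smul_mul, mul_add, add_mul, mul_sub, sub_mul, Matrix.smul_apply, Matrix.add_apply,
    Matrix.sub_apply, smul_eq_mul] at h
  have h2 := mul_nonneg (show (0 : ℂ) ≤ 2 by norm_num) h
  refine h2.trans_eq ?_
  rw [sum_trace_pauli_mul fun i => Uᴴ * E (pauli i) * U]
  ring

/-- A unitary `U` rotates the Pauli matrices by `R`. -/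
def Implements (U : Matrix (Fin 2) (Fin 2) ℂ) (R : Matrix (Fin 3) (Fin 3) ℝ) : Prop :=
  U ∈ unitaryGroup (Fin 2) ℂ ∧
    ∀ j : Fin 3, U * pauli j.succ * Uᴴ = ∑ k : Fin 3, (R k j : ℂ) • pauli k.succ

theorem IsChannel.trace_rotation_nonneg {E : SuperOp (Fin 2)} (hE : IsChannel E)
    {U : Matrix (Fin 2) (Fin 2) ℂ} {R : Matrix (Fin 3) (Fin 3) ℝ} (hU : Implements U R) :
    0 ≤ 1 + (Rᵀ * blochMatrix E).trace := by
  have h := hE.sum_trace_nonneg U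
  rw [Fin.sum_univ_succ] at h
  have hUU : U * Uᴴ = 1 := by
    simpa [star_eq_conjTranspose] using (mem_unitaryGroup_iff.mp hU.1)
  have h0 : (U * pauli 0 * Uᴴ * E (pauli 0)).trace = 2 := by
    rw [show pauli 0 = 1 from rfl, Matrix.mul_one, hUU, Matrix.one_mul, hE.2]; simp
  have hj (j : Fin 3) : (U * pauli j.succ * Uᴴ * E (pauli j.succ)).trace =
      2 * ((∑ k, R k j * blochMatrix E k j : ℝ) : ℂ) := by
    rw [hU.2, hE.hasBlochMatrix j]
    simp [Matrix.sum_mul, trace_sum, trace_pauli_mul_pauli, Finset.mul_sum]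
    refine Finset.sum_congr rfl fun k _ => ?_
    ring
  simp only [h0, hj] at h
  have h' : (0 : ℂ) ≤ ((2 + ∑ j : Fin 3, 2 * ∑ k, R k j * blochMatrix E k j : ℝ) : ℂ) := by
    push_cast at h ⊢; exact h
  have h'' := Complex.zero_le_real.mp h'
  rw [← Finset.mul_sum] at h''
  have ht : (Rᵀ * blochMatrix E).trace = ∑ j : Fin 3, ∑ k, R k j * blochMatrix E k j := by
    simp [trace, mul_apply]
  rw [ht]; linarith

/-! ### Unitaries implementing rotations. -/

/-- The Pauli matrices in rotated coordinates. -/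
noncomputable def rotatedPauli (R : Matrix (Fin 3) (Fin 3) ℝ) (j : Fin 3) :
    Matrix (Fin 2) (Fin 2) ℂ := ∑ k : Fin 3, (R k j : ℂ) • pauli k.succ

theorem rotatedPauli_isHermitian (R : Matrix (Fin 3) (Fin 3) ℝ) (j : Fin 3) :
    (rotatedPauli R j)ᴴ = rotatedPauli R j := by
  simp [rotatedPauli, conjTranspose_sum, pauli_isHermitian]

theorem rotatedPauli_eq (R : Matrix (Fin 3) (Fin 3) ℝ) (j : Fin 3) :
    rotatedPauli R j = !![(R 2 j : ℂ), R 0 j - R 1 j * Complex.I;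
      R 0 j + R 1 j * Complex.I, -R 2 j] := by
  ext a b
  fin_cases a <;> fin_cases b <;> simp [rotatedPauli, Fin.sum_univ_three, pauli]
  all_goals ring

theorem IsRotation.rotatedPauli_mul_self {R : Matrix (Fin 3) (Fin 3) ℝ} (h : IsRotation R)
    (j : Fin 3) : rotatedPauli R j * rotatedPauli R j = 1 := by
  have hj : R 0 j * R 0 j + R 1 j * R 1 j + R 2 j * R 2 j = 1 := by
    have := congrFun (congrFun h.1 j) j
    simpa [mul_apply, Fin.sum_univ_three] using this
  have hj' : (R 0 j : ℂ) * R 0 j + R 1 j * R 1 j + R 2 j * R 2 j = 1 := by exact_mod_cast hj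
  rw [rotatedPauli_eq]
  ext a b
  fin_cases a <;> fin_cases b <;> simp [mul_apply, Fin.sum_univ_two]
  · linear_combination hj' - (R 1 j : ℂ) ^ 2 * Complex.I_sq
  · ring
  · ring
  · linear_combination hj' - (R 1 j : ℂ) ^ 2 * Complex.I_sq

/-- A product of two such matrices is the dot product of their columns plus `I` times the cross
product; taking adjoints reverses the order. -/
theorem rotatedPauli_mul {R : Matrix (Fin 3) (Fin 3) ℝ} {i j k : Fin 3}
    (h : R 0 i * R 0 j + R 1 i * R 1 j + R 2 i * R 2 j = 0)
    (h0 : R 0 k = R 1 i * R 2 j - R 2 i * R 1 j) (h1 : R 1 k = R 2 i * R 0 j - R 0 i * R 2 j)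
    (h2 : R 2 k = R 0 i * R 1 j - R 1 i * R 0 j) :
    rotatedPauli R i * rotatedPauli R j = Complex.I • rotatedPauli R k ∧
      rotatedPauli R j * rotatedPauli R i = -Complex.I • rotatedPauli R k := by
  have key : rotatedPauli R i * rotatedPauli R j = Complex.I • rotatedPauli R k := by
    have h' : (R 0 i : ℂ) * R 0 j + R 1 i * R 1 j + R 2 i * R 2 j = 0 := by exact_mod_cast h
    have h0' : (R 0 k : ℂ) = R 1 i * R 2 j - R 2 i * R 1 j := by exact_mod_cast h0
    have h1' : (R 1 k : ℂ) = R 2 i * R 0 j - R 0 i * R 2 j := by exact_mod_cast h1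
    have h2' : (R 2 k : ℂ) = R 0 i * R 1 j - R 1 i * R 0 j := by exact_mod_cast h2
    simp only [rotatedPauli_eq]
    ext a b
    fin_cases a <;> fin_cases b <;> simp [mul_apply, Fin.sum_univ_two]
    · linear_combination h' - Complex.I * h2' - (R 1 i : ℂ) * R 1 j * Complex.I_sq
    · linear_combination -h1' - Complex.I * h0' + (R 1 k : ℂ) * Complex.I_sq
    · linear_combination h1' - Complex.I * h0' - (R 1 k : ℂ) * Complex.I_sq
    · linear_combination h' + Complex.I * h2' - (R 1 i : ℂ) * R 1 j * Complex.I_sq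
  refine ⟨key, ?_⟩
  have := congrArg conjTranspose key
  simpa [rotatedPauli_isHermitian] using this

theorem IsRotation.rotatedPauli_mul {R : Matrix (Fin 3) (Fin 3) ℝ} (h : IsRotation R) :
    (rotatedPauli R 0 * rotatedPauli R 1 = Complex.I • rotatedPauli R 2 ∧
      rotatedPauli R 1 * rotatedPauli R 0 = -Complex.I • rotatedPauli R 2) ∧
    (rotatedPauli R 1 * rotatedPauli R 2 = Complex.I • rotatedPauli R 0 ∧
      rotatedPauli R 2 * rotatedPauli R 1 = -Complex.I • rotatedPauli R 0) ∧
    (rotatedPauli R 2 * rotatedPauli R 0 = Complex.I • rotatedPauli R 1 ∧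
      rotatedPauli R 0 * rotatedPauli R 2 = -Complex.I • rotatedPauli R 1) := by
  have ho (i j : Fin 3) (hij : i ≠ j) : R 0 i * R 0 j + R 1 i * R 1 j + R 2 i * R 2 j = 0 := by
    have := congrFun (congrFun h.1 i) j
    simpa [mul_apply, Fin.sum_univ_three, one_apply, hij] using this
  have ha (i j : Fin 3) := congrFun (congrFun h.adjugate i) j
  have a00 := ha 0 0
  have a01 := ha 0 1
  have a02 := ha 0 2
  have a10 := ha 1 0
  have a11 := ha 1 1
  have a12 := ha 1 2
  have a20 := ha 2 0
  have a21 := ha 2 1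
  have a22 := ha 2 2
  simp [adjugate_fin_three] at a00 a01 a02 a10 a11 a12 a20 a21 a22
  refine ⟨QubitChannel.rotatedPauli_mul (ho 0 1 (by decide)) ?_ ?_ ?_,
    QubitChannel.rotatedPauli_mul (ho 1 2 (by decide)) ?_ ?_ ?_,
    QubitChannel.rotatedPauli_mul (ho 2 0 (by decide)) ?_ ?_ ?_⟩ <;> linarith

theorem rotatedPauli_one (j : Fin 3) : rotatedPauli 1 j = pauli j.succ := by
  simp [rotatedPauli, one_apply]

/-- An operator that intertwines the Pauli matrices and the rotated Pauli matrices. -/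
noncomputable def intertwiner (R : Matrix (Fin 3) (Fin 3) ℝ) (X : Matrix (Fin 2) (Fin 2) ℂ) :
    Matrix (Fin 2) (Fin 2) ℂ := X + ∑ i, rotatedPauli R i * X * pauli i.succ

/-- Both families obey the same multiplication table. Multiplying by `rotatedPauli R j` on the left
and `pauli j.succ` on the right permutes the four summands, as the phases `I` and `-I` cancel. -/
theorem IsRotation.rotatedPauli_mul_intertwiner {R : Matrix (Fin 3) (Fin 3) ℝ} (h : IsRotation R)
    (X : Matrix (Fin 2) (Fin 2) ℂ) (j : Fin 3) :
    rotatedPauli R j * intertwiner R X = intertwiner R X * pauli j.succ := by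
  obtain ⟨⟨r01, r10⟩, ⟨r12, r21⟩, ⟨r20, r02⟩⟩ := h.rotatedPauli_mul
  obtain ⟨⟨p01, p10⟩, ⟨p12, p21⟩, ⟨p20, p02⟩⟩ := isRotation_one.rotatedPauli_mul
  have r00 := h.rotatedPauli_mul_self
  have p00 := isRotation_one.rotatedPauli_mul_self
  simp only [intertwiner, ← rotatedPauli_one, Fin.sum_univ_three, mul_add, add_mul]
  simp only [← Matrix.mul_assoc]
  fin_cases j <;> simp only [Fin.zero_eta, Fin.mk_one, Fin.reduceFinMk, r00, r01, r10, r12, r21,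
    r20, r02, Matrix.mul_assoc _ (rotatedPauli 1 _) (rotatedPauli 1 _), p00, p01, p10, p12, p21,
    p20, p02, Matrix.one_mul, Matrix.mul_one, Matrix.smul_mul, Matrix.mul_smul] <;> module

theorem exists_intertwiner_ne_zero (R : Matrix (Fin 3) (Fin 3) ℝ) :
    ∃ X, intertwiner R X ≠ 0 := by
  by_contra! h
  -- Adding these two entries pairs each `rotatedPauli R i 0 0` with the zero trace of a Pauli
  -- matrix, leaving `1 + 1`.
  have h0 := congrFun (congrFun (h (single 0 0 1)) 0) 0
  have h1 := congrFun (congrFun (h (single 0 1 1)) 0) 1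
  simp [intertwiner, Fin.sum_univ_three, pauli, mul_apply, Fin.sum_univ_two] at h0 h1
  have : (2 : ℂ) = 0 := by linear_combination h0 + h1
  norm_num at this

/-- Every rotation is implemented by a unitary. -/
theorem IsRotation.exists_implements {R : Matrix (Fin 3) (Fin 3) ℝ} (h : IsRotation R) :
    ∃ U, Implements U R := by
  obtain ⟨X, hX⟩ := exists_intertwiner_ne_zero R
  set V := intertwiner R X
  have hint (j : Fin 3) : rotatedPauli R j * V = V * pauli j.succ :=
    h.rotatedPauli_mul_intertwiner X j
  have hint' (j : Fin 3) : Vᴴ * rotatedPauli R j = pauli j.succ * Vᴴ := by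
    have := congrArg conjTranspose (hint j)
    simpa [rotatedPauli_isHermitian, pauli_isHermitian] using this
  have hcomm (j : Fin 3) : Vᴴ * V * pauli j.succ = pauli j.succ * (Vᴴ * V) := by
    rw [Matrix.mul_assoc, ← hint, ← Matrix.mul_assoc, hint', Matrix.mul_assoc]
  set c : ℝ := Complex.normSq (V 0 0) + Complex.normSq (V 1 0) with hc
  have hA00 : (Vᴴ * V) 0 0 = c := by
    simp [mul_apply, Fin.sum_univ_two, hc, Complex.normSq_eq_conj_mul_self]
  -- Commuting with `σ₃` kills the off-diagonal entries and commuting with `σ₁` equates the diagonal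
  -- ones.
  have hscal : Vᴴ * V = (c : ℂ) • (1 : Matrix (Fin 2) (Fin 2) ℂ) := by
    generalize Vᴴ * V = A at hcomm hA00
    have e1 := hcomm 0
    have e2 := hcomm 2
    have e1a := congrFun (congrFun e1 0) 1
    have e2a := congrFun (congrFun e2 0) 1
    have e2b := congrFun (congrFun e2 1) 0
    simp [pauli, mul_apply, Fin.sum_univ_two] at e1a e2a e2b
    ext a b
    fin_cases a <;> fin_cases b <;> simp [hA00]
    · linear_combination (-1 / 2) * e2a
    · linear_combination (1 / 2) * e2b
    · rw [← hA00, e1a]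
  have hc0 : 0 < c := by
    have h0 : 0 ≤ c := add_nonneg (Complex.normSq_nonneg _) (Complex.normSq_nonneg _)
    refine lt_of_le_of_ne h0 fun hz => hX ?_
    rw [← hz] at hscal
    simpa using hscal
  set r : ℂ := (((Real.sqrt c)⁻¹ : ℝ) : ℂ) with hr
  have hrr : r * r * c = 1 := by
    rw [hr]
    norm_cast
    rw [← mul_inv, Real.mul_self_sqrt hc0.le, inv_mul_cancel₀ hc0.ne']
  have hrs : star r = r := by rw [hr]; exact Complex.conj_ofReal _
  have hUU : (r • V)ᴴ * (r • V) = 1 := by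
    rw [conjTranspose_smul, hrs, smul_mul_smul_comm, hscal, smul_smul, hrr, one_smul]
  have hUU' : (r • V) * (r • V)ᴴ = 1 := mul_eq_one_comm.mp hUU
  refine ⟨r • V, mem_unitaryGroup_iff.mpr hUU', fun j => ?_⟩
  change _ = rotatedPauli R j
  rw [Matrix.smul_mul, ← hint, ← Matrix.mul_smul, Matrix.mul_assoc, hUU', Matrix.mul_one]

theorem IsChannel.rotationTraceBound {E : SuperOp (Fin 2)} (hE : IsChannel E) :
    RotationTraceBound (blochMatrix E) := fun _ hR => by
  obtain ⟨U, hU⟩ := hR.exists_implements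
  exact hE.trace_rotation_nonneg hU

end Bloch

/-! ### Pauli channels and dephasing generators. -/

section PauliChannels

open Matrix

/-- The map `ρ ↦ K ρ K†`. -/
noncomputable def conjOp (K : Matrix (Fin 2) (Fin 2) ℂ) : SuperOp (Fin 2) :=
  LinearMap.toContinuousLinearMap ((LinearMap.mulLeft ℂ K).comp (LinearMap.mulRight ℂ Kᴴ))

theorem conjOp_apply (K X : Matrix (Fin 2) (Fin 2) ℂ) : conjOp K X = K * X * Kᴴ := by
  simp [conjOp, Matrix.mul_assoc]

theorem ampliate_conjOp (k : ℕ) (K : Matrix (Fin 2) (Fin 2) ℂ)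
    (X : Matrix (Fin k × Fin 2) (Fin k × Fin 2) ℂ) :
    ampliate k (conjOp K) X = kronecker (1 : Matrix (Fin k) (Fin k) ℂ) K * X *
      (kronecker (1 : Matrix (Fin k) (Fin k) ℂ) K)ᴴ := by
  ext ⟨p, a⟩ ⟨q, b⟩
  simp [ampliate, conjOp_apply, mul_apply, kronecker, kroneckerMap_apply, Fintype.sum_prod_type,
    one_apply, apply_ite, Finset.sum_ite_eq]

/-- The map `ρ ↦ ∑ i, p i σ i ρ σ i`. -/
noncomputable def pauliOp (p : Fin 4 → ℝ) : SuperOp (Fin 2) :=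
  ∑ i, (p i : ℂ) • conjOp (pauli i)

theorem pauliOp_apply (p : Fin 4 → ℝ) (X : Matrix (Fin 2) (Fin 2) ℂ) :
    pauliOp p X = ∑ i, (p i : ℂ) • (pauli i * X * pauli i) := by
  simp [pauliOp, conjOp_apply, pauli_isHermitian]

theorem continuous_pauliOp : Continuous pauliOp := by
  unfold pauliOp
  fun_prop

theorem isChannel_pauliOp {p : Fin 4 → ℝ} (hp : ∀ i, 0 ≤ p i) (hsum : ∑ i, p i = 1) :
    IsChannel (pauliOp p) := by
  constructor
  · intro k X hX
    have h : ampliate k (pauliOp p) X = ∑ i, (p i : ℂ) • ampliate k (conjOp (pauli i)) X := by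
      ext a b
      simp [ampliate, pauliOp, Matrix.sum_apply]
    rw [h]
    refine posSemidef_sum _ fun i _ => PosSemidef.smul ?_ (by exact_mod_cast hp i)
    rw [ampliate_conjOp]
    exact hX.mul_mul_conjTranspose_same _
  · intro X
    have hc : ∑ i, (p i : ℂ) = 1 := by exact_mod_cast hsum
    rw [pauliOp_apply, trace_sum]
    have (i : Fin 4) : ((p i : ℂ) • (pauli i * X * pauli i)).trace = p i * X.trace := by
      rw [trace_smul, trace_mul_comm, ← Matrix.mul_assoc, pauli_mul_self, Matrix.one_mul,
        smul_eq_mul]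
    simp only [this]
    rw [← Finset.sum_mul, hc, one_mul]

theorem pauliOp_one (p : Fin 4 → ℝ) : pauliOp p 1 = ((∑ i, p i : ℝ) : ℂ) • 1 := by
  rw [pauliOp_apply]
  simp [pauli_mul_self, Finset.sum_smul]

theorem hasBlochMatrix_pauliOp (p : Fin 4 → ℝ) :
    HasBlochMatrix (pauliOp p) (diagonal ![p 0 + p 1 - p 2 - p 3, p 0 - p 1 + p 2 - p 3,
      p 0 - p 1 - p 2 + p 3]) := by
  intro j
  rw [pauliOp_apply]
  fin_cases j <;> ext a b <;> fin_cases a <;> fin_cases b <;>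
    simp [Fin.sum_univ_four, Fin.sum_univ_three, pauli, mul_apply, Matrix.sum_apply] <;> ring_nf

/-- The weights of the Pauli channel that multiplies `σ₁, σ₂, σ₃` by `s`. -/
noncomputable def pauliWeights (s : Fin 3 → ℝ) : Fin 4 → ℝ :=
  ![(1 + s 0 + s 1 + s 2) / 4, (1 + s 0 - s 1 - s 2) / 4, (1 - s 0 + s 1 - s 2) / 4,
    (1 - s 0 - s 1 + s 2) / 4]

theorem sum_pauliWeights (s : Fin 3 → ℝ) : ∑ i, pauliWeights s i = 1 := by
  simp [pauliWeights, Fin.sum_univ_four]; ring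

theorem continuous_pauliWeights : Continuous pauliWeights := by
  unfold pauliWeights
  refine continuous_pi fun i => ?_
  fin_cases i <;> simp <;> fun_prop

theorem pauliOp_pauliWeights_one (s : Fin 3 → ℝ) : pauliOp (pauliWeights s) 1 = 1 := by
  rw [pauliOp_one, sum_pauliWeights]; simp

theorem hasBlochMatrix_pauliWeights (s : Fin 3 → ℝ) :
    HasBlochMatrix (pauliOp (pauliWeights s)) (diagonal s) := by
  convert hasBlochMatrix_pauliOp (pauliWeights s) using 2
  ext i
  fin_cases i <;> simp [pauliWeights] <;> ring

theorem pauliWeights_nonneg {s : Fin 3 → ℝ} (hs : ∀ i, 0 ≤ s i) (h0 : s 1 + s 2 ≤ 1 + s 0)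
    (h1 : s 0 + s 2 ≤ 1 + s 1) (h2 : s 0 + s 1 ≤ 1 + s 2) (i : Fin 4) : 0 ≤ pauliWeights s i := by
  have := hs 0; have := hs 1; have := hs 2
  fin_cases i <;> simp [pauliWeights] <;> linarith

theorem exp_apply_of_apply_eq_smul {L : SuperOp (Fin 2)} {v : Matrix (Fin 2) (Fin 2) ℂ} {c : ℂ}
    (h : L v = c • v) : NormedSpace.exp L v = Complex.exp c • v := by
  have h1 := NormedSpace.exp_series_hasSum_exp' (𝕂 := ℂ) L
  have h2 := ((ContinuousLinearMap.apply ℂ _ v).hasSum h1)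
  have h3 := (NormedSpace.exp_series_hasSum_exp' (𝕂 := ℂ) c).smul_const v
  rw [← Complex.exp_eq_exp_ℂ] at h3
  have hpow (n : ℕ) : (L ^ n) v = c ^ n • v := by
    induction n with
    | zero => simp
    | succ n ih =>
      rw [pow_succ, mul_apply_eq_comp, h, map_smul, ih, smul_smul, pow_succ, mul_comm]
  have he : (fun n : ℕ => ((n.factorial : ℂ)⁻¹ • c ^ n) • v) =
      fun n : ℕ => ContinuousLinearMap.apply ℂ _ v ((n.factorial : ℂ)⁻¹ • L ^ n) := by
    ext1 n
    rw [map_smul, ContinuousLinearMap.apply_apply, hpow, smul_assoc]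
  rw [he] at h3
  exact h2.unique h3

/-- The dephasing generator with rates `g` on the three axes. -/
noncomputable def pauliGenerator (g : Fin 3 → ℝ) : SuperOp (Fin 2) :=
  pauliOp ![-(g 0 + g 1 + g 2), g 0, g 1, g 2]

/-- Pauli matrices square to `1`, so the anticommutators collapse to the negative multiple of `X`
carried by the weight of `σ₀`. -/
theorem isLindblad_pauliGenerator {g : Fin 3 → ℝ} (hg : ∀ i, 0 ≤ g i) :
    IsLindblad (pauliGenerator g) := by
  refine ⟨0, 3, diagonal fun i => (g i : ℂ), fun i => pauli i.succ, isHermitian_zero, ?_, ?_⟩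
  · exact PosSemidef.diagonal fun i => by simpa using hg i
  · intro X
    rw [pauliGenerator, pauliOp_apply]
    simp only [diagonal_apply, ite_smul, zero_smul, Finset.sum_ite_eq, Finset.mem_univ, if_true,
      pauli_isHermitian, pauli_mul_self, Matrix.one_mul, Matrix.mul_one, Matrix.mul_zero,
      Matrix.zero_mul, sub_zero, smul_zero, zero_add]
    rw [Fin.sum_univ_succ, Fin.sum_univ_three, Fin.sum_univ_three]
    simp only [show pauli 0 = 1 from rfl, Matrix.one_mul, Matrix.mul_one]
    simp
    module

/-- A Pauli channel with positive parameters satisfying `s i * s j ≤ s k` is the exponential of a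
dephasing generator. -/
theorem exists_isLindblad_exp {s : Fin 3 → ℝ} (hs : ∀ i, 0 < s i) (h0 : s 1 * s 2 ≤ s 0)
    (h1 : s 0 * s 2 ≤ s 1) (h2 : s 0 * s 1 ≤ s 2) :
    ∃ L, IsLindblad L ∧ pauliOp (pauliWeights s) = NormedSpace.exp L := by
  let l : Fin 3 → ℝ := fun i => Real.log (s i)
  -- Solves `l i = -2 * (g j + g k)`; nonnegative rates are the product inequalities in logarithmic
  -- form.
  let g : Fin 3 → ℝ := ![(l 0 - l 1 - l 2) / 4, (l 1 - l 0 - l 2) / 4, (l 2 - l 0 - l 1) / 4]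
  have hlog (i j k : Fin 3) (h : s i * s j ≤ s k) : l i + l j ≤ l k := by
    have := Real.log_le_log (mul_pos (hs i) (hs j)) h
    rwa [Real.log_mul (hs i).ne' (hs j).ne'] at this
  have hg : ∀ i, 0 ≤ g i := by
    have := hlog _ _ _ h0
    have := hlog _ _ _ h1
    have := hlog _ _ _ h2
    intro i; fin_cases i <;> simp [g] <;> linarith
  refine ⟨pauliGenerator g, isLindblad_pauliGenerator hg, ?_⟩
  have hL : HasBlochMatrix (pauliGenerator g) (diagonal l) := by
    have h := hasBlochMatrix_pauliOp ![-(g 0 + g 1 + g 2), g 0, g 1, g 2]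
    rw [← pauliGenerator] at h
    convert h using 2
    ext i
    fin_cases i <;> simp [g] <;> ring
  refine (hasBlochMatrix_pauliWeights s).ext (fun j => ?_) ?_
  · have hj : pauliGenerator g (pauli j.succ) = (l j : ℂ) • pauli j.succ := by
      rw [hL j]
      simp [diagonal_apply, apply_ite]
    rw [exp_apply_of_apply_eq_smul hj, ← Complex.ofReal_exp, Real.exp_log (hs j)]
    simp [diagonal_apply, apply_ite]
  · have h1 : pauliGenerator g 1 = (0 : ℂ) • 1 := by
      rw [pauliGenerator, pauliOp_one]
      simp [Fin.sum_univ_four]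
      ring
    rw [pauliOp_pauliWeights_one, exp_apply_of_apply_eq_smul h1]
    simp

theorem add_le_one_add_of_mul_le {a b c : ℝ} (ha : a ≤ 1) (hb : b ≤ 1) (h : a * b ≤ c) :
    a + b ≤ 1 + c := by
  nlinarith

/-- Zero parameters have no logarithm; raising all parameters to at least `d > 0` keeps the
inequalities, and `d → 0` gives the closure. -/
theorem isLDivisible_pauliOp {s : Fin 3 → ℝ} (hs : ∀ i, 0 ≤ s i) (hone : ∀ i, s i ≤ 1)
    (h0 : s 1 * s 2 ≤ s 0) (h1 : s 0 * s 2 ≤ s 1) (h2 : s 0 * s 1 ≤ s 2) :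
    IsLDivisible (pauliOp (pauliWeights s)) := by
  have hch {t : Fin 3 → ℝ} (ht : ∀ i, 0 ≤ t i) (hone : ∀ i, t i ≤ 1)
      (h0 : t 1 * t 2 ≤ t 0) (h1 : t 0 * t 2 ≤ t 1) (h2 : t 0 * t 1 ≤ t 2) :
      IsChannel (pauliOp (pauliWeights t)) :=
    isChannel_pauliOp (pauliWeights_nonneg ht (add_le_one_add_of_mul_le (hone 1) (hone 2) h0)
      (add_le_one_add_of_mul_le (hone 0) (hone 2) h1)
      (add_le_one_add_of_mul_le (hone 0) (hone 1) h2)) (sum_pauliWeights t)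
  refine ⟨hch hs hone h0 h1 h2, ?_⟩
  let t : ℝ → Fin 3 → ℝ := fun d i => max (s i) d
  have hcont : Continuous fun d => pauliOp (pauliWeights (t d)) :=
    continuous_pauliOp.comp (continuous_pauliWeights.comp (by fun_prop))
  have ht0 : t 0 = s := by ext i; exact max_eq_left (hs i)
  have hlim : Filter.Tendsto (fun d => pauliOp (pauliWeights (t d))) (nhdsWithin 0 (Set.Ioi 0))
      (nhds (pauliOp (pauliWeights s))) := by
    have := hcont.tendsto 0
    rw [ht0] at this
    exact this.mono_left nhdsWithin_le_nhds
  refine mem_closure_of_tendsto hlim ?_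
  have hmem : ∀ᶠ d : ℝ in nhdsWithin 0 (Set.Ioi 0), 0 < d ∧ d < 1 :=
    Ioo_mem_nhdsGT one_pos
  filter_upwards [hmem] with d hd
  -- If either factor is replaced by `d`, the other is at most `1`, so the product is at most `d`.
  have hmul {a b c : ℝ} (ha : 0 ≤ a) (ha1 : a ≤ 1) (hb1 : b ≤ 1) (hb : 0 ≤ b) (h : a * b ≤ c) :
      max a d * max b d ≤ max c d := by
    rcases le_total a d with had | had <;> rcases le_total b d with hbd | hbd <;>
      simp only [max_eq_left, max_eq_right, had, hbd]
    · exact le_max_of_le_right (mul_le_of_le_one_left hd.1.le hd.2.le)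
    · exact le_max_of_le_right (mul_le_of_le_one_right hd.1.le hb1)
    · exact le_max_of_le_right (mul_le_of_le_one_left hd.1.le ha1)
    · exact le_max_of_le_left h
  have htpos : ∀ i, 0 < t d i := fun i => lt_max_of_lt_right hd.1
  have ht1 : ∀ i, t d i ≤ 1 := fun i => max_le (hone i) hd.2.le
  have e0 : t d 1 * t d 2 ≤ t d 0 := hmul (hs 1) (hone 1) (hone 2) (hs 2) h0
  have e1 : t d 0 * t d 2 ≤ t d 1 := hmul (hs 0) (hone 0) (hone 2) (hs 2) h1
  have e2 : t d 0 * t d 1 ≤ t d 2 := hmul (hs 0) (hone 0) (hone 1) (hs 1) h2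
  obtain ⟨L, hL, he⟩ := exists_isLindblad_exp htpos e0 e1 e2
  refine ⟨hch (fun i => (htpos i).le) ht1 e0 e1 e2, ?_, L, hL, he⟩
  rw [he]
  let _ : NormedAlgebra ℚ (SuperOp (Fin 2)) := NormedAlgebra.restrictScalars ℚ ℂ _
  exact NormedSpace.isUnit_exp L

end PauliChannels

/-! ### From infinitesimal divisibility to the decomposition. -/

section Main

open Matrix

theorem eventually_adjugateBound_blochMatrix {n : ℕ} (hn : 0 < n) :
    ∃ ε > 0, ∀ F : SuperOp (Fin 2), IsChannel F ∧ ‖F - 1‖ < ε →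
      AdjugateBound n (blochMatrix F) ∧ 0 < (blochMatrix F).det := by
  have h1 : Filter.Tendsto blochMatrix (nhds 1) (nhds 1) := by
    have := continuous_blochMatrix.tendsto 1
    rwa [hasBlochMatrix_one.blochMatrix_eq] at this
  obtain ⟨ε, hε, h⟩ := Metric.eventually_nhds_iff.mp (h1.eventually (eventually_adjugateBound hn))
  exact ⟨ε, hε, fun F hF => h (by rw [dist_eq_norm]; exact hF.2) hF.1.rotationTraceBound⟩

theorem hasBlochMatrix_list_prod (l : List (SuperOp (Fin 2))) (h : ∀ F ∈ l, IsChannel F) :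
    HasBlochMatrix l.prod (l.map blochMatrix).prod := by
  induction l with
  | nil => exact hasBlochMatrix_one
  | cons F l ih =>
    rw [List.prod_cons, List.map_cons, List.prod_cons]
    exact (h F (by simp)).hasBlochMatrix.mul (ih fun G hG => h G (by simp [hG]))

theorem adjugateLe_of_mem_infinitesimalProducts {E : SuperOp (Fin 2)}
    (hE : E ∈ infinitesimalProducts (n := Fin 2)) :
    AdjugateLe (blochMatrix E) ∧ 0 ≤ (blochMatrix E).det := by
  have key (n : ℕ) (hn : 0 < n) :
      AdjugateBound n (blochMatrix E) ∧ 0 < (blochMatrix E).det := by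
    obtain ⟨ε, hε, h⟩ := eventually_adjugateBound_blochMatrix hn
    obtain ⟨l, hl, rfl⟩ := hE.2 ε hε
    rw [(hasBlochMatrix_list_prod l fun F hF => (hl F hF).1).blochMatrix_eq]
    refine adjugateBound_list_prod _ fun M hM => ?_
    obtain ⟨F, hF, rfl⟩ := List.mem_map.mp hM
    exact h F (hl F hF)
  exact ⟨adjugateLe_of_forall_adjugateBound (key 1 one_pos).2 fun n hn => (key n hn).1,
    (key 1 one_pos).2.le⟩

theorem IsInfinitesimalDivisible.adjugateLe {E : SuperOp (Fin 2)}
    (hE : IsInfinitesimalDivisible E) :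
    AdjugateLe (blochMatrix E) ∧ 0 ≤ (blochMatrix E).det := by
  have hcl := isClosed_adjugateLe_and_det_nonneg.preimage continuous_blochMatrix
  exact closure_minimal (fun F hF => adjugateLe_of_mem_infinitesimalProducts hF) hcl hE.2

theorem Implements.hasBlochMatrix {U : Matrix (Fin 2) (Fin 2) ℂ} {R : Matrix (Fin 3) (Fin 3) ℝ}
    (h : Implements U R) : HasBlochMatrix (conjOp U) R := fun j => by
  rw [conjOp_apply, h.2]

theorem conjOp_one {U : Matrix (Fin 2) (Fin 2) ℂ} (h : U ∈ unitaryGroup (Fin 2) ℂ) :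
    conjOp U 1 = 1 := by
  rw [conjOp_apply, Matrix.mul_one]
  exact mem_unitaryGroup_iff.mp h

end Main
end QubitChannel

open QubitChannel Matrix in
theorem mainTheorem5 (E : QubitChannel.SuperOp (Fin 2))
    (hdiv : QubitChannel.IsInfinitesimalDivisible E) (hunital : QubitChannel.IsUnital E) :
    ∃ U₁ E' U₂ : QubitChannel.SuperOp (Fin 2),
      QubitChannel.IsUnitaryConjugation U₁ ∧ QubitChannel.IsUnitaryConjugation U₂ ∧
      QubitChannel.IsPauliChannel E' ∧ QubitChannel.IsLDivisible E' ∧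
      E = U₁ * E' * U₂ ∧
      (IsUnit E → ∃ L : QubitChannel.SuperOp (Fin 2),
        QubitChannel.IsLindblad L ∧ E' = NormedSpace.exp L) := by
  obtain ⟨hle, hdet⟩ := hdiv.adjugateLe
  have hE := hdiv.1
  obtain ⟨R₁, R₂, s, h₁, h₂, hs, hM⟩ := exists_rotation_svd hdet
  have htr := hE.rotationTraceBound
  have hbloch := hE.hasBlochMatrix
  rw [hM] at hle htr hbloch
  obtain ⟨b0, b1, b2⟩ := htr.le_diagonal h₁ h₂
  have hone : ∀ i, s i ≤ 1 := by
    intro i; fin_cases i <;> dsimp <;> linarith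
  have hlk := hle.le_diagonal h₁ h₂ hs
  have c0 : s 1 * s 2 ≤ s 0 := hlk 0 0
  have c1 : s 0 * s 2 ≤ s 1 := hlk 1 1
  have c2 : s 0 * s 1 ≤ s 2 := hlk 2 2
  obtain ⟨U₁, hU₁⟩ := h₁.exists_implements
  obtain ⟨U₂, hU₂⟩ := h₂.exists_implements
  have heq : E = conjOp U₁ * pauliOp (pauliWeights s) * conjOp U₂ := by
    refine hbloch.ext ((hU₁.hasBlochMatrix.mul (hasBlochMatrix_pauliWeights s)).mul
      hU₂.hasBlochMatrix) ?_
    rw [mul_apply_eq_comp, mul_apply_eq_comp, conjOp_one hU₂.1, pauliOp_pauliWeights_one,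
      conjOp_one hU₁.1]
    exact hunital
  refine ⟨conjOp U₁, pauliOp (pauliWeights s), conjOp U₂, ⟨U₁, hU₁.1, conjOp_apply U₁⟩,
    ⟨U₂, hU₂.1, conjOp_apply U₂⟩, ⟨pauliWeights s, pauliWeights_nonneg hs b0 b1 b2,
    sum_pauliWeights s, pauliOp_apply _⟩, isLDivisible_pauliOp hs hone c0 c1 c2, heq,
    fun hunit => ?_⟩
  refine exists_isLindblad_exp (fun k => lt_of_le_of_ne (hs k) fun hk => ?_) c0 c1 c2
  have hUU : U₂ * U₂ᴴ = 1 := mem_unitaryGroup_iff.mp hU₂.1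
  -- A vanishing `s k` would put this nonzero matrix in the kernel of the invertible `E`.
  have hker : E (U₂ᴴ * pauli k.succ * U₂) = 0 := by
    have hU : conjOp U₂ (U₂ᴴ * pauli k.succ * U₂) = pauli k.succ := by
      rw [conjOp_apply]
      calc U₂ * (U₂ᴴ * pauli k.succ * U₂) * U₂ᴴ = (U₂ * U₂ᴴ) * pauli k.succ * (U₂ * U₂ᴴ) := by
            simp only [Matrix.mul_assoc]
        _ = pauli k.succ := by rw [hUU, Matrix.one_mul, Matrix.mul_one]
    rw [heq, mul_apply_eq_comp, mul_apply_eq_comp, hU, hasBlochMatrix_pauliWeights s k]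
    have : ∑ i : Fin 3, ((diagonal s i k : ℝ) : ℂ) • pauli i.succ = 0 := by
      refine Finset.sum_eq_zero fun i _ => ?_
      rcases eq_or_ne i k with rfl | hik
      · simp [← hk]
      · simp [diagonal_apply_ne _ hik]
    rw [this, map_zero]
  obtain ⟨F, hF⟩ := hunit.exists_left_inv
  have hzero : U₂ᴴ * pauli k.succ * U₂ = 0 := by
    have := congrArg (fun T : SuperOp (Fin 2) => T (U₂ᴴ * pauli k.succ * U₂)) hF
    simpa [mul_apply_eq_comp, hker] using this.symm
  have hσ : pauli k.succ = 0 := by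
    calc pauli k.succ = (U₂ * U₂ᴴ) * pauli k.succ * (U₂ * U₂ᴴ) := by
          rw [hUU, Matrix.one_mul, Matrix.mul_one]
      _ = U₂ * (U₂ᴴ * pauli k.succ * U₂) * U₂ᴴ := by simp only [Matrix.mul_assoc]
      _ = 0 := by rw [hzero, Matrix.mul_zero, Matrix.zero_mul]
  have h1 := pauli_mul_self k.succ
  rw [hσ, Matrix.mul_zero] at h1
  exact zero_ne_one h1
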